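/- Fix $d\in\mathbb N$ and a standard Borel space $(E,\mathcal E)$. Let $S=\mathbb Z^d$, $\Omega=E^S$ with the product $\sigma$-algebra $\mathcal F$, and let $\mathcal F_\Lambda\subset\mathcal F$ be the $\sigma$-algebra generated by the states in $\Lambda\subset S$. Let $\mathcal P(\Omega)$ be the set of probability measures on $(\Omega,\mathcal F)$ and, for finite $\Lambda\subset S$ and $\mu\in\mathcal P(\Omega)$, let $\mu_\Lambda$ be the marginal of $\mu$ on $E^\Lambda$. Put $\Delta_n=\{-n,\dots,n\}^d$. For $z\in S$ let $(\theta_z\omega)_x=\omega_{x+z}$; $\mu\in\mathcal P(\Omega)$ is shift-invariant if $\mu(\theta_zA)=\mu(A)$ for all $z\in S$, $A\in\mathcal F$. A specification is a family $\gamma=(\gamma_\Lambda)_\Lambda$, indexed by the finite sets $\Lambda\subset S$, of probability kernels $\gamma_\Lambda$ from $(\Omega,\mathcal F_{S\setminus\Lambda})$ to $(\Omega,\mathcal F)$ such that $\gamma_\Lambda(A,\omega)=1_A(\omega)$ for $A\in\mathcal F_{S\setminus\Lambda}$, and $\gamma_\Delta\gamma_\Lambda=\gamma_\Delta$ for $\Lambda\subset\Delta$.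 Let $\hat\gamma_\Lambda(\cdot,\omega)$ be the marginal of $\gamma_\Lambda(\cdot,\omega)$ on $E^\Lambda$, and let $\mathcal B_\Lambda(\gamma)=\{\nu\hat\gamma_\Lambda:\nu\in\mathcal P(\Omega)\}$ be the set of finite-volume Gibbs measures in $\Lambda$ with arbitrary mixed boundary conditions. For a set $\mathcal B$ of probability measures on a measurable space put $$\operatorname{Diam}^\infty\mathcal B=\sup_{\mu,\nu\in\mathcal B}\log\inf\{\lambda\ge0:\mu\le\lambda\nu\}.$$ The specification $\gamma$ is weakly dependent if $\gamma_{\Lambda+z}(A,\omega)=\gamma_\Lambda(\theta_zA,\theta_z\omega)$ for all finite $\Lambda\subset S$, $z\in S$, $A\in\mathcal F$, $\omega\in\Omega$, if $\operatorname{Diam}^\infty\mathcal B_\Lambda(\gamma)<\infty$ for every finite $\Lambda\subset S$, and if $\operatorname{Diam}^\infty\mathcal B_{\Delta_n}(\gamma)=o(|\Delta_n|)$ as $n\to\infty$. Let $\gamma$ be a weakly dependent specification. Write $\mathcal H(\cdot|\cdot)$ for relative entropy. 1. For every shift-invariant $\mu\in\mathcal P(\Omega)$ the specific free energy $$h(\mu|\gamma)=\lim_{n\to\infty}|\Delta_n|^{-1}\,\mathcal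 H\big(\mu_{\Delta_n}\,\big|\,(\nu\gamma_{\Delta_n})_{\Delta_n}\big)\in[0,\infty]$$ exists for every $\nu\in\mathcal P(\Omega)$ and does not depend on $\nu$. Let $h_0(\gamma)$ be the set of minimizers of $\gamma$, that is, of shift-invariant $\mu\in\mathcal P(\Omega)$ with $h(\mu|\gamma)=0$. 2. The set $h_0(\gamma)$ equals the set of all shift-invariant $\mu\in\mathcal P(\Omega)$ for which there is a sequence $(\nu^n)_{n\in\mathbb N}\subset\mathcal P(\Omega)$ with $\nu^n\gamma_{\Delta_n}\to\mu$ in the topology of local convergence, the coarsest topology on $\mathcal P(\Omega)$ that makes $\mu\mapsto\mu(A)$ continuous for every $A\in\bigcup_{\Lambda\subset S\text{ finite}}\mathcal F_\Lambda$. 3. A shift-invariant $\mu\in\mathcal P(\Omega)$ belongs to $h_0(\gamma)$ if and only if, for every $n\in\mathbb N$, the marginal $\mu_{\Delta_n}$ lies in the closure of $\mathcal B_{\Delta_n}(\gamma)$ in the strong topology on the probability measures on $E^{\Delta_n}$, the coarsest topology that makes $\mu\mapsto\mu(A)$ continuous for every measurable $A\subset E^{\Delta_n}$. -/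

import Mathlib

open MeasureTheory ProbabilityTheory Filter Topology Asymptotics
open scoped ENNReal NNReal

noncomputable section

namespace RandomField

/-- The lattice `ℤ^d`. -/
abbrev Site (d : ℕ) : Type := Fin d → ℤ

/-- Configurations `ω : ℤ^d → E`, with the product `σ`-algebra. -/
abbrev Config (d : ℕ) (E : Type*) : Type _ := Site d → E

/-- The box `Δ_n = {-n, …, n}^d`. -/
def box (d n : ℕ) : Finset (Site d) := Fintype.piFinset fun _ => Finset.Icc (-(n : ℤ)) (n : ℤ)

/-- The translate `Λ + z` of a finite set of sites. -/
def translate {d : ℕ} (z : Site d) (Λ : Finset (Site d)) : Finset (Site d) :=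
  Λ.image fun x => x + z

/-- The shift of configurations, `(θ_z ω)_x = ω_{x + z}`. -/
def shift {d : ℕ} {E : Type*} (z : Site d) (ω : Config d E) : Config d E := fun x => ω (x + z)

/-- Shift-invariance of a random field: `μ (θ A) = μ A` for all shifts `θ` and measurable `A`. -/
def ShiftInvariant {d : ℕ} {E : Type*} [MeasurableSpace E]
    (μ : ProbabilityMeasure (Config d E)) : Prop :=
  ∀ (z : Site d) (A : Set (Config d E)), MeasurableSet A →
    (μ : Measure (Config d E)) (shift z '' A) = (μ : Measure (Config d E)) A

/-- The marginal `μ_Λ` of a random field on `E^Λ`. -/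
def marginal {d : ℕ} {E : Type*} [MeasurableSpace E] (Λ : Finset (Site d))
    (μ : ProbabilityMeasure (Config d E)) : ProbabilityMeasure (Λ → E) :=
  μ.map (f := Λ.restrict) (Finset.measurable_restrict Λ).aemeasurable

/-- The max-entropy `log inf {l ≥ 0 : μ ≤ l ν}`, with value `⊤` if there is no such `l`. -/
def maxEntropy {X : Type*} [MeasurableSpace X] (μ ν : Measure X) : EReal :=
  ENNReal.log (⨅ (l : ℝ≥0) (_ : μ ≤ l • ν), (l : ℝ≥0∞))

/-- The max-diameter of a set of probability measures. -/
def maxDiam {X : Type*} [MeasurableSpace X] (B : Set (ProbabilityMeasure X)) : EReal :=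
  ⨆ μ ∈ B, ⨆ ν ∈ B, maxEntropy (μ : Measure X) (ν : Measure X)

/-- The strong topology: the coarsest topology making `μ ↦ μ A` continuous for every
measurable set `A`. -/
abbrev strongTopology (X : Type*) [MeasurableSpace X] : TopologicalSpace (ProbabilityMeasure X) :=
  ⨅ (A : Set X) (_ : MeasurableSet A),
    TopologicalSpace.induced (fun μ : ProbabilityMeasure X => (μ : Measure X) A) inferInstance

/-- The topology of local convergence on random fields: the coarsest topology making `μ ↦ μ A`
continuous for every event `A` depending on the states in a finite set of sites only. -/
abbrev localTopology (d : ℕ) (E : Type*) [MeasurableSpace E] :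
    TopologicalSpace (ProbabilityMeasure (Config d E)) :=
  ⨅ (Λ : Finset (Site d)) (A : Set (Config d E))
    (_ : MeasurableSet[cylinderEvents (X := fun _ : Site d => E) (Λ : Set (Site d))] A),
    TopologicalSpace.induced
      (fun μ : ProbabilityMeasure (Config d E) => (μ : Measure (Config d E)) A) inferInstance

/-- A specification: a proper and consistent family of probability kernels `γ_Λ` from
`(Ω, 𝓕_{S ∖ Λ})` to `(Ω, 𝓕)`, indexed by the finite sets of sites. (For `Λ = ∅` properness forces
`γ_∅` to be the identity kernel, so that the empty set carries no information.) -/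
structure Specification (d : ℕ) (E : Type*) [MeasurableSpace E] where
  /-- The kernel `γ_Λ`. -/
  ker : Finset (Site d) → Kernel (Config d E) (Config d E)
  isMarkov : ∀ Λ, IsMarkovKernel (ker Λ)
  /-- `γ_Λ(A, ·)` depends measurably on the configuration outside `Λ` only. -/
  measurable_outside : ∀ (Λ : Finset (Site d)) (A : Set (Config d E)), MeasurableSet A →
    Measurable[cylinderEvents (X := fun _ : Site d => E) (Λ : Set (Site d))ᶜ]
      (fun ω => ker Λ ω A)
  proper : ∀ (Λ : Finset (Site d)) (A : Set (Config d E)),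
    MeasurableSet[cylinderEvents (X := fun _ : Site d => E) (Λ : Set (Site d))ᶜ] A →
      ∀ ω, ker Λ ω A = A.indicator 1 ω
  /-- `γ_Δ = γ_Δ γ_Λ`. -/
  consistent : ∀ Λ Δ : Finset (Site d), Λ ⊆ Δ → ∀ ω, (ker Δ ω).bind (ker Λ) = ker Δ ω

namespace Specification

variable {d : ℕ} {E : Type*} [MeasurableSpace E]

instance (γ : Specification d E) (Λ : Finset (Site d)) : IsMarkovKernel (γ.ker Λ) := γ.isMarkov Λ

/-- The random field `ν γ_Λ`. -/
def bind (γ : Specification d E) (ν : ProbabilityMeasure (Config d E)) (Λ : Finset (Site d)) :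
    ProbabilityMeasure (Config d E) :=
  ⟨(ν : Measure (Config d E)).bind (γ.ker Λ), inferInstance⟩

/-- The kernel from configurations to `E^Λ` giving the finite-volume Gibbs measures with
deterministic boundary conditions. -/
def hat (γ : Specification d E) (Λ : Finset (Site d)) : Kernel (Config d E) (Λ → E) :=
  (γ.ker Λ).map Λ.restrict

instance (γ : Specification d E) (Λ : Finset (Site d)) : IsMarkovKernel (γ.hat Λ) :=
  Kernel.IsMarkovKernel.map _ (Finset.measurable_restrict Λ)

/-- The finite-volume Gibbs measure on `E^Λ` with mixed boundary conditions `ν`. -/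
def gibbs (γ : Specification d E) (ν : ProbabilityMeasure (Config d E)) (Λ : Finset (Site d)) :
    ProbabilityMeasure (Λ → E) :=
  ⟨(ν : Measure (Config d E)).bind (γ.hat Λ), inferInstance⟩

/-- The set of all finite-volume Gibbs measures on `E^Λ` with mixed boundary conditions. -/
def gibbsSet (γ : Specification d E) (Λ : Finset (Site d)) : Set (ProbabilityMeasure (Λ → E)) :=
  Set.range fun ν => γ.gibbs ν Λ

/-- Shift-invariance: `γ_{θΛ}(A, ω) = γ_Λ(θA, θω)`. -/
def IsShiftInvariant (γ : Specification d E) : Prop :=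
  ∀ (z : Site d) (Λ : Finset (Site d)) (A : Set (Config d E)), MeasurableSet A →
    ∀ ω, γ.ker (translate z Λ) ω A = γ.ker Λ (shift z ω) (shift z '' A)

/-- Weak dependence: shift-invariance, finite max-diameters in every finite volume, and
max-diameter `o(|Δ_n|)` in the box `Δ_n`. -/
structure WeaklyDependent (γ : Specification d E) : Prop where
  shiftInvariant : γ.IsShiftInvariant
  diam_lt_top : ∀ Λ : Finset (Site d), maxDiam (γ.gibbsSet Λ) < ⊤
  diam_isLittleO :
    (fun n : ℕ => (maxDiam (γ.gibbsSet (box d n))).toReal) =o[atTop]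
      fun n : ℕ => ((box d n).card : ℝ)

/-- `h` is the specific free energy of `μ` relative to `γ`: the limit of
`|Δ_n|⁻¹ 𝓗_{Δ_n}(μ | ν γ_{Δ_n})`, for each choice of the random field `ν`. -/
def IsSpecificFreeEnergy (γ : Specification d E) (μ : ProbabilityMeasure (Config d E))
    (h : ℝ≥0∞) : Prop :=
  ∀ ν : ProbabilityMeasure (Config d E),
    Tendsto (fun n : ℕ =>
      InformationTheory.klDiv (marginal (box d n) μ : Measure (box d n → E))
        (marginal (box d n) (γ.bind ν (box d n)) : Measure (box d n → E)) / ((box d n).card : ℝ≥0∞))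
      atTop (𝓝 h)

/-- The set `h₀(γ)` of minimizers: shift-invariant random fields of specific free energy zero. -/
def minimizers (γ : Specification d E) : Set (ProbabilityMeasure (Config d E)) :=
  {μ | ShiftInvariant μ ∧ γ.IsSpecificFreeEnergy μ 0}

/-- The set of limits of finite-volume Gibbs measures `ν_n γ_{Δ_n}` in the topology of local
convergence. -/
def limits (γ : Specification d E) : Set (ProbabilityMeasure (Config d E)) :=
  {μ | ∃ ν : ℕ → ProbabilityMeasure (Config d E),
    Tendsto (fun n => γ.bind (ν n) (box d n)) atTop (@nhds _ (localTopology d E) μ)}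

/-- The set of shift-invariant limits of finite-volume Gibbs measures. -/
def shiftInvariantLimits (γ : Specification d E) : Set (ProbabilityMeasure (Config d E)) :=
  γ.limits ∩ {μ | ShiftInvariant μ}

end Specification

end RandomField

end

/-! The central quantity is `minEntropy μ Λ`, the infimum of the entropy of `μ_Λ` relative to the
finite-volume Gibbs measures in `Λ`. It is superadditive: if `γ_Λ` preserves `Q` and `V` is disjoint
from `Λ`, the conditional law of `Λ` given `V` under `Q` is a mixture of the kernels `γ̂_Λ`.
Averaged over `μ_V` it is again a Gibbs measure, so the chain rule splits off at least `minEntropy μ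
Λ` (`klDiv_marginal_add_minEntropy_le`). Packing `Δ_n` with translates of `Δ_m` then bounds the
entropy density below by that of `Δ_m`. Conversely, changing the reference measure costs at most the
max-diameter (`klDiv_le_add_log`), which is `o(|Δ_n|)`. So the limit exists and is the supremum of
the densities of `minEntropy`.

The characterizations follow in a cycle. If the supremum is zero, every `minEntropy μ Δ_n` vanishes,
and Pinsker's inequality yields Gibbs measures converging locally to `μ`. By consistency, local
limits have marginals in the closures. A measure in the closure is still dominated by `exp Diam`
times any Gibbs measure, so its entropy is at most `Diam = o(|Δ_n|)`. -/

namespace RandomField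

open InformationTheory

/-! ### Relative entropy: chain rule, change of reference measure, Pinsker. -/

/-- Superadditivity of relative entropy: if `κ` is a conditional distribution of `g` given `f`
under `Q`, then the entropy of the pair dominates the entropy of `f` plus the entropy of `g`
relative to the average of `κ`. -/
lemma klDiv_map_add_klDiv_comp_le {α X Y : Type*} [MeasurableSpace α] [MeasurableSpace X]
    [MeasurableSpace Y] [StandardBorelSpace Y] [Nonempty Y] (P Q : Measure α)
    [IsProbabilityMeasure P] [IsProbabilityMeasure Q] {f : α → X} {g : α → Y} (hf : Measurable f)
    (hg : Measurable g) (κ : Kernel X Y) [IsMarkovKernel κ]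
    (hκ : Q.map (fun a => (f a, g a)) = Q.map f ⊗ₘ κ) :
    klDiv (P.map f) (Q.map f) + klDiv (P.map g) ((P.map f).bind κ) ≤
      klDiv (P.map fun a => (f a, g a)) (Q.map fun a => (f a, g a)) := by
  have := Measure.isProbabilityMeasure_map (μ := P) hf.aemeasurable
  have := Measure.isProbabilityMeasure_map (μ := Q) hf.aemeasurable
  rw [hκ, ← compProd_map_condDistrib (μ := P) (X := f) hg.aemeasurable, klDiv_compProd_eq_add]
  gcongr
  -- Forgetting the first coordinate can only decrease the conditional entropy term.
  have h := klDiv_map_le (P.map f ⊗ₘ condDistrib g f P) (P.map f ⊗ₘ κ) measurable_snd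
  rwa [← Measure.snd, ← Measure.snd, Measure.snd_compProd, Measure.snd_compProd,
    condDistrib_comp_map hf.aemeasurable hg.aemeasurable] at h

/-- Used with `x = dμ/dP` and `y = dP/dQ`. The summands `y` and `1` both integrate to one under `Q`;
keeping them on opposite sides avoids subtraction in `ℝ≥0∞`. -/
lemma klFun_mul_add_le {x y c : ℝ} (hx : 0 ≤ x) (hy : 0 ≤ y) (hyc : y ≤ c) :
    klFun (x * y) + y ≤ y * klFun x + Real.log c * (x * y) + 1 := by
  rcases hx.eq_or_lt with rfl | hx
  · simp [klFun_apply, add_comm]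
  rcases hy.eq_or_lt with rfl | hy
  · simp [klFun_apply]
  have : Real.log y * (x * y) ≤ Real.log c * (x * y) := by
    gcongr
  rw [klFun_apply, klFun_apply, Real.log_mul hx.ne' hy.ne']
  nlinarith

lemma klDiv_le_add_log {X : Type*} [MeasurableSpace X] (μ P Q : Measure X)
    [IsProbabilityMeasure μ] [IsProbabilityMeasure P] [IsProbabilityMeasure Q] {c : ℝ}
    (hc : 1 ≤ c) (h : P ≤ ENNReal.ofReal c • Q) :
    klDiv μ Q ≤ klDiv μ P + ENNReal.ofReal (Real.log c) := by
  by_cases hμP : μ ≪ P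
  swap
  · simp [hμP]
  have hPQ : P ≪ Q := (Measure.absolutelyContinuous_of_le h).trans
    Measure.smul_absolutelyContinuous
  have hle : ∀ᵐ x ∂Q, P.rnDeriv Q x ≤ ENNReal.ofReal c := by
    refine ae_le_of_forall_setLIntegral_le_of_sigmaFinite (Measure.measurable_rnDeriv P Q)
      fun s hs _ => ?_
    rw [Measure.setLIntegral_rnDeriv hPQ, lintegral_const, Measure.restrict_apply_univ]
    exact h s
  rw [klDiv_eq_lintegral_klFun_of_ac (hμP.trans hPQ), klDiv_eq_lintegral_klFun_of_ac hμP]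
  set F : X → ℝ≥0∞ := fun x => ENNReal.ofReal (klFun (μ.rnDeriv P x).toReal) with hF
  have hFm : Measurable F := by fun_prop
  have hlog : 0 ≤ Real.log c := Real.log_nonneg hc
  have key : ∀ᵐ x ∂Q, ENNReal.ofReal (klFun (μ.rnDeriv Q x).toReal) + P.rnDeriv Q x ≤
      P.rnDeriv Q x * F x + ENNReal.ofReal (Real.log c) * μ.rnDeriv Q x + 1 := by
    filter_upwards [hle, Measure.rnDeriv_mul_rnDeriv (κ := Q) hμP, Measure.rnDeriv_lt_top P Q,
      Measure.rnDeriv_lt_top μ Q] with x h1 h2 h3 h4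
    rw [Pi.mul_apply] at h2
    -- `dμ/dP` is finite only `P`-almost everywhere; where it is infinite, `dP/dQ` must vanish.
    rcases eq_or_ne (μ.rnDeriv P x) ∞ with hX | hX
    · have hY : P.rnDeriv Q x = 0 := by
        by_contra hY
        rw [hX, ENNReal.top_mul hY] at h2
        exact h4.ne h2.symm
      rw [hY, mul_zero] at h2
      simp [← h2, hY, klFun_zero]
    · have hk := klFun_mul_add_le (ENNReal.toReal_nonneg (a := μ.rnDeriv P x))
        (ENNReal.toReal_nonneg (a := P.rnDeriv Q x))
        (ENNReal.toReal_le_of_le_ofReal (by linarith) h1)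
      have hkX := klFun_nonneg (ENNReal.toReal_nonneg (a := μ.rnDeriv P x))
      have hk' := ENNReal.ofReal_le_ofReal hk
      rw [ENNReal.ofReal_add (klFun_nonneg (by positivity)) (by positivity),
        ENNReal.ofReal_add (by positivity) zero_le_one,
        ENNReal.ofReal_add (by positivity) (by positivity), ENNReal.ofReal_mul (by positivity),
        ENNReal.ofReal_mul hlog, ← ENNReal.toReal_mul, h2, ENNReal.ofReal_toReal h3.ne,
        ENNReal.ofReal_toReal h4.ne, ENNReal.ofReal_one] at hk'
      exact hk'
  have hint := lintegral_mono_ae key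
  rw [lintegral_add_right _ (Measure.measurable_rnDeriv P Q),
    lintegral_add_right _ measurable_const, lintegral_add_right _ (by fun_prop),
    lintegral_const_mul _ (by fun_prop), Measure.lintegral_rnDeriv hPQ,
    Measure.lintegral_rnDeriv (hμP.trans hPQ), lintegral_rnDeriv_mul hPQ hFm.aemeasurable] at hint
  simpa [ENNReal.add_le_add_iff_right] using hint

/-- `klFun` dominates the squared Hellinger integrand `(√x - 1)²`; Young's inequality applied to
`|√x - 1| (√x + 1)` does the rest. -/
lemma abs_sub_one_le_klFun {x ε : ℝ} (hx : 0 ≤ x) (hε : 0 < ε) :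
    |x - 1| ≤ ε⁻¹ * klFun x + ε * (x + 1) := by
  have hsq : (√x - 1) ^ 2 ≤ klFun x := by
    rcases hx.eq_or_lt with rfl | hx
    · simp [klFun_apply]
    have hs : 0 < √x := Real.sqrt_pos.2 hx
    have hl : 1 - (√x)⁻¹ ≤ Real.log √x := Real.one_sub_inv_le_log_of_pos hs
    have hl2 : √x - 1 ≤ √x * Real.log √x := by
      calc √x - 1 = √x * (1 - (√x)⁻¹) := by field_simp
        _ ≤ _ := by gcongr
    have hx2 : √x * √x = x := Real.mul_self_sqrt hx.le
    rw [Real.log_sqrt hx.le] at hl2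
    rw [klFun_apply]
    nlinarith
  have hs : 0 ≤ √x := Real.sqrt_nonneg x
  have hx2 : √x * √x = x := Real.mul_self_sqrt hx
  set s := √x
  have habs : |x - 1| = |s - 1| * (s + 1) := by
    rw [← hx2, show s * s - 1 = (s - 1) * (s + 1) by ring, abs_mul,
      abs_of_nonneg (by positivity : 0 ≤ s + 1)]
  have h1 : ε⁻¹ * (s - 1) ^ 2 ≤ ε⁻¹ * klFun x := by gcongr
  have h2 : 0 ≤ (ε⁻¹ * |s - 1| - (s + 1) / 2) ^ 2 * ε := by positivity
  have h3 : (ε⁻¹ * |s - 1| - (s + 1) / 2) ^ 2 * ε =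
      ε⁻¹ * |s - 1| ^ 2 - |s - 1| * (s + 1) + ε * (s + 1) ^ 2 / 4 := by
    field_simp
    ring
  rw [sq_abs] at h3
  nlinarith [mul_nonneg hε.le (sq_nonneg (s - 1)), mul_nonneg hε.le (mul_nonneg hs hs)]

/-- A weak form of Pinsker's inequality. -/
lemma abs_measureReal_sub_le_klDiv {X : Type*} [MeasurableSpace X] (μ ν : Measure X)
    [IsProbabilityMeasure μ] [IsProbabilityMeasure ν] (h : klDiv μ ν ≠ ∞) {ε : ℝ} (hε : 0 < ε)
    (A : Set X) :
    |μ.real A - ν.real A| ≤ ε⁻¹ * (klDiv μ ν).toReal + 2 * ε := by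
  obtain ⟨hac, hint⟩ := klDiv_ne_top_iff.1 h
  have hk : Integrable (fun x => klFun (μ.rnDeriv ν x).toReal) ν :=
    (integrable_klFun_rnDeriv_iff hac).2 hint
  have hd : Integrable (fun x => (μ.rnDeriv ν x).toReal) ν := Measure.integrable_toReal_rnDeriv
  have h1 : μ.real A - ν.real A = ∫ x in A, ((μ.rnDeriv ν x).toReal - 1) ∂ν := by
    rw [integral_sub hd.integrableOn (integrable_const _), Measure.setIntegral_toReal_rnDeriv hac]
    simp
  have hb : Integrable (fun x => ε⁻¹ * klFun (μ.rnDeriv ν x).toReal +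
      ε * ((μ.rnDeriv ν x).toReal + 1)) ν :=
    (hk.const_mul _).add ((hd.add (integrable_const _)).const_mul _)
  calc |μ.real A - ν.real A| ≤ ∫ x in A, |(μ.rnDeriv ν x).toReal - 1| ∂ν := by
        rw [h1]; exact abs_integral_le_integral_abs
    _ ≤ ∫ x, |(μ.rnDeriv ν x).toReal - 1| ∂ν :=
        setIntegral_le_integral (hd.sub (integrable_const _)).abs
          (ae_of_all _ fun _ => abs_nonneg _)
    _ ≤ ∫ x, ε⁻¹ * klFun (μ.rnDeriv ν x).toReal + ε * ((μ.rnDeriv ν x).toReal + 1) ∂ν :=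
        integral_mono (hd.sub (integrable_const _)).abs hb
          fun x => abs_sub_one_le_klFun ENNReal.toReal_nonneg hε
    _ = _ := by
        have hd' : Integrable (fun x => (μ.rnDeriv ν x).toReal + 1) ν :=
          hd.add (integrable_const _)
        rw [integral_add (hk.const_mul _) (hd'.const_mul _),
          integral_const_mul, integral_const_mul, integral_add hd (integrable_const _),
          Measure.integral_toReal_rnDeriv hac, toReal_klDiv_eq_integral_klFun hac]
        simp
        ring

/-! ### Marginals, shifts and cylinder events. -/

variable {d : ℕ} {E : Type*} [MeasurableSpace E]

lemma coe_marginal (Λ : Finset (Site d)) (μ : ProbabilityMeasure (Config d E)) :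
    (marginal Λ μ : Measure (Λ → E)) = (μ : Measure (Config d E)).map Λ.restrict := rfl

lemma marginal_apply (Λ : Finset (Site d)) (μ : ProbabilityMeasure (Config d E)) {A : Set (Λ → E)}
    (hA : MeasurableSet A) : (marginal Λ μ : Measure (Λ → E)) A =
      (μ : Measure (Config d E)) (Λ.restrict ⁻¹' A) :=
  Measure.map_apply (Finset.measurable_restrict Λ) hA

lemma measurable_shift (z : Site d) : Measurable (shift z : Config d E → Config d E) :=
  measurable_pi_lambda _ fun x => measurable_pi_apply (x + z)

lemma shift_neg_shift {d : ℕ} {E : Type*} (z : Site d) (ω : Config d E) :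
    shift (-z) (shift z ω) = ω := by
  funext x; simp [shift]

lemma shift_shift_neg {d : ℕ} {E : Type*} (z : Site d) (ω : Config d E) :
    shift z (shift (-z) ω) = ω := by
  funext x; simp [shift]

lemma shift_image {d : ℕ} {E : Type*} (z : Site d) (A : Set (Config d E)) :
    shift z '' A = shift (-z) ⁻¹' A :=
  congrFun (Set.image_eq_preimage_of_inverse (shift_neg_shift z) (shift_shift_neg z)) A

lemma ShiftInvariant.map_shift {μ : ProbabilityMeasure (Config d E)} (hμ : ShiftInvariant μ)
    (z : Site d) : (μ : Measure (Config d E)).map (shift z) = μ := by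
  ext A hA
  rw [Measure.map_apply (measurable_shift z) hA, ← hμ (-z) A hA, shift_image, neg_neg]

lemma measurableSet_cylinderEvents_preimage_restrict {V : Finset (Site d)} {A : Set (V → E)}
    (hA : MeasurableSet A) :
    MeasurableSet[cylinderEvents (X := fun _ : Site d => E) (V : Set (Site d))]
      (V.restrict ⁻¹' A : Set (Config d E)) :=
  measurable_restrict_cylinderEvents (X := fun _ : Site d => E) (V : Set (Site d)) hA

lemma exists_eq_preimage_restrict {V : Finset (Site d)} {A : Set (Config d E)}
    (hA : MeasurableSet[cylinderEvents (X := fun _ : Site d => E) (V : Set (Site d))] A) :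
    ∃ B : Set (V → E), MeasurableSet B ∧ A = V.restrict ⁻¹' B := by
  have hle : cylinderEvents (X := fun _ : Site d => E) (V : Set (Site d)) ≤
      MeasurableSpace.comap (V.restrict : Config d E → V → E) inferInstance := by
    refine iSup₂_le fun i hi => ?_
    have : (fun σ : Config d E => σ i) = (fun σ : V → E => σ ⟨i, hi⟩) ∘ V.restrict := rfl
    rw [this, ← MeasurableSpace.comap_comp]
    exact MeasurableSpace.comap_mono (measurable_pi_apply (⟨i, hi⟩ : V)).comap_le
  obtain ⟨B, hB, rfl⟩ := hle A hA
  exact ⟨B, hB, rfl⟩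

/-! ### Gibbs kernels and superadditivity of the minimal entropy. -/

namespace Specification

variable (γ : Specification d E)

lemma coe_bind (ν : ProbabilityMeasure (Config d E)) (Λ : Finset (Site d)) :
    (γ.bind ν Λ : Measure (Config d E)) = (ν : Measure (Config d E)).bind (γ.ker Λ) := rfl

lemma marginal_bind (ν : ProbabilityMeasure (Config d E)) (Λ : Finset (Site d)) :
    marginal Λ (γ.bind ν Λ) = γ.gibbs ν Λ := by
  apply Subtype.ext
  change ((ν : Measure (Config d E)).bind (γ.ker Λ)).map Λ.restrict =
    (ν : Measure (Config d E)).bind (γ.hat Λ)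
  rw [Measure.map_comp _ _ (Finset.measurable_restrict Λ), hat]

/-- A Gibbs measure in `Δ` serves as its own boundary condition in every smaller volume. -/
lemma bind_bind (ν : ProbabilityMeasure (Config d E)) {Λ Δ : Finset (Site d)} (h : Λ ⊆ Δ) :
    γ.bind (γ.bind ν Δ) Λ = γ.bind ν Δ := by
  apply Subtype.ext
  change ((ν : Measure (Config d E)).bind (γ.ker Δ)).bind (γ.ker Λ) = _
  rw [Measure.bind_bind (Kernel.aemeasurable _) (Kernel.aemeasurable _)]
  simp_rw [γ.consistent Λ Δ h]
  rfl

/-- Properness gives events outside `Λ` probability zero or one, so they factor out. -/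
lemma ker_inter_of_outside (Λ : Finset (Site d)) {A : Set (Config d E)}
    (hA : MeasurableSet[cylinderEvents (X := fun _ : Site d => E) (Λ : Set (Site d))ᶜ] A)
    (B : Set (Config d E)) (ω : Config d E) :
    γ.ker Λ ω (A ∩ B) = A.indicator (fun ω => γ.ker Λ ω B) ω := by
  have h := γ.proper Λ A hA ω
  by_cases hω : ω ∈ A
  · rw [Set.indicator_of_mem hω] at h ⊢
    have hA0 : ∀ᵐ η ∂γ.ker Λ ω, η ∈ A :=
      (prob_compl_eq_zero_iff (cylinderEvents_le_pi A hA)).2 h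
    exact le_antisymm (measure_mono Set.inter_subset_right)
      (measure_mono_ae (hA0.mono fun η hη hB => ⟨hη, hB⟩))
  · rw [Set.indicator_of_notMem hω] at h ⊢
    exact measure_mono_null Set.inter_subset_left h

/-- The conditional distribution of the states in `Λ` given those in `V` disjoint from `Λ`, under a
random field `Q` preserved by `γ_Λ`. -/
noncomputable def condKer [Nonempty (Config d E)] [StandardBorelSpace E] (Λ V : Finset (Site d))
    (Q : ProbabilityMeasure (Config d E)) : Kernel (V → E) (Λ → E) :=
  γ.hat Λ ∘ₖ condDistrib id (V.restrict : Config d E → V → E) (Q : Measure (Config d E))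

instance [Nonempty (Config d E)] [StandardBorelSpace E] (Λ V : Finset (Site d))
    (Q : ProbabilityMeasure (Config d E)) : IsMarkovKernel (γ.condKer Λ V Q) := by
  unfold condKer; infer_instance

lemma map_restrict_prod_eq_compProd [Nonempty (Config d E)] [StandardBorelSpace E]
    {Λ V : Finset (Site d)} (hV : Disjoint V Λ) {Q : ProbabilityMeasure (Config d E)}
    (hQ : γ.bind Q Λ = Q) :
    (Q : Measure (Config d E)).map (fun ω => (V.restrict ω, Λ.restrict ω)) =
      (Q : Measure (Config d E)).map V.restrict ⊗ₘ γ.condKer Λ V Q := by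
  have hmV : Measurable (V.restrict : Config d E → V → E) := Finset.measurable_restrict V
  have hmΛ : Measurable (Λ.restrict : Config d E → Λ → E) := Finset.measurable_restrict Λ
  have hmP : Measurable (fun ω : Config d E => (V.restrict ω, Λ.restrict ω)) := hmV.prodMk hmΛ
  have hm1 := Measure.isProbabilityMeasure_map (μ := (Q : Measure (Config d E))) hmP.aemeasurable
  refine Measure.ext_prod fun {A B} hA hB => ?_
  have hA' : MeasurableSet (V.restrict ⁻¹' A : Set (Config d E)) := hmV hA
  have hB' : MeasurableSet (Λ.restrict ⁻¹' B : Set (Config d E)) := hmΛ hB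
  have hout : MeasurableSet[cylinderEvents (X := fun _ : Site d => E) (Λ : Set (Site d))ᶜ]
      (V.restrict ⁻¹' A : Set (Config d E)) := by
    refine cylinderEvents_mono (fun x hx hx' => ?_) _
      (measurableSet_cylinderEvents_preimage_restrict hA)
    exact Finset.disjoint_left.1 hV hx hx'
  have hhat : ∀ ω, γ.hat Λ ω B = γ.ker Λ ω (Λ.restrict ⁻¹' B) := fun ω => by
    rw [hat, Kernel.map_apply' _ hmΛ _ hB]
  have hm : Measurable fun ω => γ.hat Λ ω B := Kernel.measurable_coe _ hB
  have hm2 : Measurable fun p : (V → E) × Config d E => γ.hat Λ p.2 B := hm.comp measurable_snd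
  calc (Q : Measure (Config d E)).map (fun ω => (V.restrict ω, Λ.restrict ω)) (A ×ˢ B)
      = (γ.bind Q Λ : Measure (Config d E)) (V.restrict ⁻¹' A ∩ Λ.restrict ⁻¹' B) := by
        rw [hQ, Measure.map_apply hmP (hA.prod hB)]; rfl
    _ = ∫⁻ ω in V.restrict ⁻¹' A, γ.hat Λ ω B ∂(Q : Measure (Config d E)) := by
        rw [coe_bind, Measure.bind_apply (hA'.inter hB') (Kernel.aemeasurable _),
          ← lintegral_indicator hA']
        simp_rw [ker_inter_of_outside γ Λ hout, hhat]
    _ = ∫⁻ p in A ×ˢ Set.univ, γ.hat Λ p.2 B ∂((Q : Measure (Config d E)).map V.restrict ⊗ₘ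
          condDistrib id (V.restrict : Config d E → V → E) (Q : Measure (Config d E))) := by
        rw [compProd_map_condDistrib aemeasurable_id, setLIntegral_map (hA.prod MeasurableSet.univ)
          hm2 (hmV.prodMk measurable_id)]
        congr 2
        ext; simp
    _ = ∫⁻ x in A, γ.condKer Λ V Q x B ∂((Q : Measure (Config d E)).map V.restrict) := by
        rw [Measure.setLIntegral_compProd hm2 hA
          MeasurableSet.univ]
        simp_rw [Measure.restrict_univ, condKer, Kernel.comp_apply' _ _ _ hB]
    _ = _ := by
        rw [Measure.compProd_apply_prod hA hB]

/-- The minimal relative entropy of `μ` in `Λ` with respect to a finite-volume Gibbs measure. -/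
noncomputable def minEntropy (μ : ProbabilityMeasure (Config d E)) (Λ : Finset (Site d)) : ℝ≥0∞ :=
  ⨅ π ∈ γ.gibbsSet Λ, klDiv (marginal Λ μ : Measure (Λ → E)) (π : Measure (Λ → E))

lemma minEntropy_le (μ ν : ProbabilityMeasure (Config d E)) (Λ : Finset (Site d)) :
    γ.minEntropy μ Λ ≤ klDiv (marginal Λ μ : Measure (Λ → E)) (γ.gibbs ν Λ : Measure (Λ → E)) :=
  iInf₂_le _ ⟨ν, rfl⟩

lemma klDiv_marginal_mono (μ ν : ProbabilityMeasure (Config d E)) {Λ Δ : Finset (Site d)}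
    (h : Λ ⊆ Δ) :
    klDiv (marginal Λ μ : Measure (Λ → E)) (marginal Λ ν : Measure (Λ → E)) ≤
      klDiv (marginal Δ μ : Measure (Δ → E)) (marginal Δ ν : Measure (Δ → E)) := by
  have hm : Measurable (Finset.restrict₂ (π := fun _ : Site d => E) h) :=
    Finset.measurable_restrict₂ h
  have := klDiv_map_le (marginal Δ μ : Measure (Δ → E)) (marginal Δ ν : Measure (Δ → E)) hm
  rwa [coe_marginal, coe_marginal, Measure.map_map hm (Finset.measurable_restrict Δ),
    Measure.map_map hm (Finset.measurable_restrict Δ)] at this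

lemma klDiv_marginal_add_minEntropy_le [StandardBorelSpace E] {Λ V : Finset (Site d)}
    (hV : Disjoint V Λ) (μ : ProbabilityMeasure (Config d E)) {Q : ProbabilityMeasure (Config d E)}
    (hQ : γ.bind Q Λ = Q) :
    klDiv (marginal V μ : Measure (V → E)) (marginal V Q : Measure (V → E)) + γ.minEntropy μ Λ ≤
      klDiv (marginal (V ∪ Λ) μ : Measure ((V ∪ Λ : Finset (Site d)) → E))
        (marginal (V ∪ Λ) Q : Measure ((V ∪ Λ : Finset (Site d)) → E)) := by
  have : Nonempty (Config d E) := nonempty_of_isProbabilityMeasure (μ : Measure (Config d E))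
  have : Nonempty (Λ → E) := this.map Λ.restrict
  have hmV : Measurable (V.restrict : Config d E → V → E) := Finset.measurable_restrict V
  have hmΛ : Measurable (Λ.restrict : Config d E → Λ → E) := Finset.measurable_restrict Λ
  have hVm := Measure.isProbabilityMeasure_map (μ := (μ : Measure (Config d E))) hmV.aemeasurable
  have hle := klDiv_map_add_klDiv_comp_le (μ : Measure (Config d E)) (Q : Measure (Config d E))
    hmV hmΛ _ (γ.map_restrict_prod_eq_compProd hV hQ)
  -- Draw the states in `V` from `μ` and complete the configuration by the conditional law under
  -- `Q`: this boundary condition shows that the averaged kernel is a Gibbs measure.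
  let ν : ProbabilityMeasure (Config d E) :=
    ⟨((μ : Measure (Config d E)).map V.restrict).bind
      (condDistrib id (V.restrict : Config d E → V → E) (Q : Measure (Config d E))), inferInstance⟩
  have hν : ((μ : Measure (Config d E)).map V.restrict).bind (γ.condKer Λ V Q) =
      (γ.gibbs ν Λ : Measure (Λ → E)) := by
    rw [condKer, ← Measure.comp_assoc]; rfl
  rw [hν] at hle
  refine (add_le_add_right (γ.minEntropy_le μ ν Λ) _).trans (hle.trans ?_)
  have hg : Measurable fun x : (V ∪ Λ : Finset (Site d)) → E =>
      (Finset.restrict₂ (π := fun _ => E) Finset.subset_union_left x,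
        Finset.restrict₂ (π := fun _ => E) Finset.subset_union_right x) :=
    (Finset.measurable_restrict₂ (X := fun _ : Site d => E) Finset.subset_union_left).prodMk
      (Finset.measurable_restrict₂ (X := fun _ : Site d => E) Finset.subset_union_right)
  have := klDiv_map_le (marginal (V ∪ Λ) μ : Measure ((V ∪ Λ : Finset (Site d)) → E))
    (marginal (V ∪ Λ) Q : Measure ((V ∪ Λ : Finset (Site d)) → E)) hg
  rw [coe_marginal, coe_marginal, Measure.map_map hg (Finset.measurable_restrict _),
    Measure.map_map hg (Finset.measurable_restrict _)] at this
  exact this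

/-- Induction on the volumes: the union of those already treated plays the role of `V`. -/
lemma sum_minEntropy_le [StandardBorelSpace E] {ι : Type*} (s : Finset ι)
    (Λ : ι → Finset (Site d)) (hs : (s : Set ι).PairwiseDisjoint Λ)
    (μ : ProbabilityMeasure (Config d E)) {Q : ProbabilityMeasure (Config d E)}
    (hQ : ∀ i ∈ s, γ.bind Q (Λ i) = Q) :
    ∑ i ∈ s, γ.minEntropy μ (Λ i) ≤
      klDiv (marginal (s.biUnion Λ) μ : Measure (s.biUnion Λ → E))
        (marginal (s.biUnion Λ) Q : Measure (s.biUnion Λ → E)) := by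
  classical
  induction s using Finset.induction_on with
  | empty => simp
  | insert i s hi ih =>
    rw [Finset.sum_insert hi, Finset.biUnion_insert, add_comm, Finset.union_comm]
    have hdisj : Disjoint (s.biUnion Λ) (Λ i) := by
      rw [Finset.disjoint_biUnion_left]
      intro j hj
      exact hs (by simp [hj]) (by simp) (by rintro rfl; exact hi hj)
    refine le_trans ?_ (γ.klDiv_marginal_add_minEntropy_le hdisj μ (hQ i (by simp)))
    gcongr
    exact ih (hs.subset (by simp)) fun j hj => hQ j (by simp [hj])

end Specification

/-! ### Packing boxes by translated boxes. -/

lemma card_box (d n : ℕ) : (box d n).card = (2 * n + 1) ^ d := by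
  have : ((n : ℤ) + 1 + n).toNat = 2 * n + 1 := by omega
  simp [box, this]

lemma mem_box {d n : ℕ} {x : Site d} : x ∈ box d n ↔ ∀ j, -(n : ℤ) ≤ x j ∧ x j ≤ n := by
  simp [box]

lemma mem_translate {z x : Site d} {Λ : Finset (Site d)} : x ∈ translate z Λ ↔ x - z ∈ Λ := by
  simp only [translate, Finset.mem_image]
  exact ⟨by rintro ⟨y, hy, rfl⟩; simpa using hy, fun h => ⟨_, h, by simp⟩⟩

lemma box_mono (d : ℕ) : Monotone (box d) := fun m n h x hx => by
  rw [mem_box] at hx ⊢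
  intro j
  have := hx j
  omega

lemma exists_subset_box (Λ : Finset (Site d)) : ∃ n, Λ ⊆ box d n := by
  refine ⟨Λ.sup fun x => Finset.univ.sup fun j => (x j).natAbs, fun x hx => mem_box.2 fun j => ?_⟩
  have h1 : (x j).natAbs ≤ Finset.univ.sup fun j => (x j).natAbs :=
    Finset.le_sup (f := fun j => (x j).natAbs) (Finset.mem_univ j)
  have h2 := Finset.le_sup (f := fun x : Site d => Finset.univ.sup fun j => (x j).natAbs) hx
  omega

/-- The centres of a packing of the box `Δ_n` by translates of `Δ_m`. -/
def packing (d m n : ℕ) (t : Fin d → Fin ((2 * n + 1) / (2 * m + 1))) : Site d :=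
  fun j => -(n : ℤ) + m + (2 * m + 1) * ((t j : ℕ) : ℤ)

lemma translate_packing_subset (m n : ℕ) (t : Fin d → Fin ((2 * n + 1) / (2 * m + 1))) :
    translate (packing d m n t) (box d m) ⊆ box d n := fun x hx => by
  rw [mem_translate, mem_box] at hx
  refine mem_box.2 fun j => ?_
  have h := hx j
  simp only [packing, Pi.sub_apply] at h
  have hk : (t j : ℕ) + 1 ≤ (2 * n + 1) / (2 * m + 1) := (t j).2
  have hk' := (Nat.le_div_iff_mul_le (by omega)).1 hk
  have hk'' : (((t j : ℕ) : ℤ) + 1) * (2 * m + 1) ≤ 2 * n + 1 := by exact_mod_cast hk'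
  have : (0 : ℤ) ≤ (2 * m + 1) * ((t j : ℕ) : ℤ) := by positivity
  constructor <;> linarith

lemma disjoint_translate_packing (m n : ℕ) :
    Pairwise (Function.onFun Disjoint
      fun t => translate (packing d m n t) (box d m)) := by
  intro t t' htt'
  rw [Function.onFun, Finset.disjoint_left]
  intro x hx hx'
  refine htt' (funext fun j => Fin.ext ?_)
  rw [mem_translate, mem_box] at hx hx'
  have h := hx j
  have h' := hx' j
  simp only [packing, Pi.sub_apply] at h h'
  -- Centres differ by multiples of `2m + 1` in each coordinate, but a common point forces a
  -- difference of at most `2m`.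
  have key : ∀ a b : ℤ, (2 * (m : ℤ) + 1) * a ≤ (2 * m + 1) * b + 2 * m → a ≤ b := by
    intro a b hab
    by_contra hlt
    have : (2 * (m : ℤ) + 1) * (b + 1) ≤ (2 * m + 1) * a :=
      mul_le_mul_of_nonneg_left (by omega) (by positivity)
    linarith
  have h1 := key (t j : ℕ) (t' j : ℕ) (by linarith)
  have h2 := key (t' j : ℕ) (t j : ℕ) (by linarith)
  omega

lemma tendsto_packing_density (d m : ℕ) :
    Tendsto (fun n : ℕ => (((2 * n + 1) / (2 * m + 1) : ℕ) : ℝ≥0∞) ^ d / ((box d n).card : ℝ≥0∞))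
      atTop (𝓝 ((box d m).card : ℝ≥0∞)⁻¹) := by
  have h1 : Tendsto (fun n : ℕ => 2 * (n : ℝ) + 1) atTop atTop :=
    tendsto_atTop_add_const_right _ _
      (tendsto_natCast_atTop_atTop.const_mul_atTop (by norm_num))
  have h2 := ((tendsto_nat_floor_mul_div_atTop
    (by positivity : (0 : ℝ) ≤ (2 * (m : ℝ) + 1)⁻¹)).comp h1).pow d
  have h3 := ENNReal.tendsto_ofReal h2
  have e1 : ENNReal.ofReal ((2 * (m : ℝ) + 1)⁻¹ ^ d) = ((box d m).card : ℝ≥0∞)⁻¹ := by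
    rw [card_box, inv_pow, ENNReal.ofReal_inv_of_pos (by positivity)]
    congr 1
    rw [← ENNReal.ofReal_natCast]
    push_cast
    rfl
  rw [e1] at h3
  refine h3.congr fun n => ?_
  have e2 : ⌊(2 * (m : ℝ) + 1)⁻¹ * (2 * n + 1)⌋₊ = (2 * n + 1) / (2 * m + 1) := by
    rw [← Nat.floor_div_eq_div (K := ℝ)]
    push_cast
    rw [div_eq_inv_mul]
  simp only [Function.comp_apply, e2]
  rw [card_box, div_pow, ENNReal.ofReal_div_of_pos (by positivity)]
  congr 1
  · rw [← ENNReal.ofReal_natCast, ENNReal.ofReal_pow (by positivity)]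
  · rw [← ENNReal.ofReal_natCast]
    push_cast
    rfl

/-! ### Max-diameter and the two topologies. -/

lemma toReal_maxDiam_nonneg_and_le_smul {X : Type*} [MeasurableSpace X]
    {B : Set (ProbabilityMeasure X)} (hB : maxDiam B < ⊤) {P Q : ProbabilityMeasure X}
    (hP : P ∈ B) (hQ : Q ∈ B) : 0 ≤ (maxDiam B).toReal ∧
      (P : Measure X) ≤ ENNReal.ofReal (Real.exp (maxDiam B).toReal) • (Q : Measure X) := by
  have hne : ∃ l : ℝ≥0, (P : Measure X) ≤ l • (Q : Measure X) := by
    by_contra hne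
    refine hB.not_ge (le_iSup₂_of_le P hP (le_iSup₂_of_le Q hQ ?_))
    simp [maxEntropy, not_exists.1 hne]
  set c : ℝ≥0∞ := ⨅ (l : ℝ≥0) (_ : (P : Measure X) ≤ l • (Q : Measure X)), (l : ℝ≥0∞) with hc
  -- The infimum is attained, since domination can be tested on each set separately.
  have hPQ : (P : Measure X) ≤ c • (Q : Measure X) := Measure.le_iff'.2 fun A => by
    rw [Measure.smul_apply, smul_eq_mul, hc, iInf_subtype', ENNReal.iInf_mul' (by simp)
      fun _ => ⟨⟨_, hne.choose_spec⟩⟩]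
    exact le_iInf fun l => l.2 A
  -- Comparing total masses makes the diameter nonnegative, hence not `⊥`, so `toReal` loses
  -- nothing.
  have hc1 : 1 ≤ c := by simpa using hPQ Set.univ
  have hD : ENNReal.log c ≤ maxDiam B := le_iSup₂_of_le P hP (le_iSup₂_of_le Q hQ le_rfl)
  have h0 : 0 ≤ maxDiam B := le_trans (by rw [← ENNReal.log_one]; exact ENNReal.log_monotone hc1) hD
  have hcoe : ((maxDiam B).toReal : EReal) = maxDiam B :=
    EReal.coe_toReal hB.ne (ne_bot_of_le_ne_bot EReal.zero_ne_bot h0)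
  refine ⟨EReal.toReal_nonneg h0, hPQ.trans ?_⟩
  have hce : c ≤ ENNReal.ofReal (Real.exp (maxDiam B).toReal) := by
    rw [← EReal.exp_coe, hcoe, ← ENNReal.exp_log c]
    exact EReal.exp_monotone hD
  exact Measure.le_iff'.2 fun A => by
    rw [Measure.smul_apply, Measure.smul_apply, smul_eq_mul, smul_eq_mul]; gcongr

lemma tendsto_strongTopology_iff {X ι : Type*} [MeasurableSpace X] {l : Filter ι}
    {u : ι → ProbabilityMeasure X} {μ : ProbabilityMeasure X} :
    Tendsto u l (@nhds _ (strongTopology X) μ) ↔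
      ∀ A, MeasurableSet A →
        Tendsto (fun i => (u i : Measure X) A) l (𝓝 ((μ : Measure X) A)) := by
  simp only [nhds_iInf, nhds_induced, tendsto_iInf, tendsto_comap_iff]
  rfl

lemma tendsto_localTopology_iff {ι : Type*} {l : Filter ι}
    {u : ι → ProbabilityMeasure (Config d E)} {μ : ProbabilityMeasure (Config d E)} :
    Tendsto u l (@nhds _ (localTopology d E) μ) ↔
      ∀ (Λ : Finset (Site d)) (A : Set (Config d E)),
        MeasurableSet[cylinderEvents (X := fun _ : Site d => E) (Λ : Set (Site d))] A →
        Tendsto (fun i => (u i : Measure (Config d E)) A) l (𝓝 ((μ : Measure (Config d E)) A)) := by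
  simp only [nhds_iInf, nhds_induced, tendsto_iInf, tendsto_comap_iff]
  rfl

/-! ### Existence of the specific free energy. -/

namespace Specification

variable {γ : Specification d E}

/-- The shift carries `ν γ_{Λ+z}` to `ν' γ_Λ` with `ν'` the shifted boundary condition, and it fixes
`μ`. -/
lemma minEntropy_le_translate (hγ : γ.IsShiftInvariant) {μ : ProbabilityMeasure (Config d E)}
    (hμ : ShiftInvariant μ) (z : Site d) (Λ : Finset (Site d)) :
    γ.minEntropy μ Λ ≤ γ.minEntropy μ (translate z Λ) := by
  refine le_iInf₂ fun π hπ => ?_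
  obtain ⟨ν, rfl⟩ := hπ
  have hz := measurable_shift (E := E) z
  let r : (translate z Λ → E) → Λ → E :=
    fun x s => x ⟨s + z, mem_translate.2 (by simp)⟩
  have hr : Measurable r := measurable_pi_lambda _ fun s => measurable_pi_apply _
  have hm := Finset.measurable_restrict (X := fun _ : Site d => E) (translate z Λ)
  have hmΛ := Finset.measurable_restrict (X := fun _ : Site d => E) Λ
  have hmap : ∀ ρ : Measure (Config d E),
      (ρ.map (translate z Λ).restrict).map r = (ρ.map (shift z)).map Λ.restrict := fun ρ => by
    rw [Measure.map_map hr hm, Measure.map_map hmΛ hz]; rfl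
  let ν' : ProbabilityMeasure (Config d E) := ν.map hz.aemeasurable
  have hbind : (γ.bind ν (translate z Λ) : Measure (Config d E)).map (shift z) =
      γ.bind ν' Λ := by
    ext A hA
    rw [Measure.map_apply hz hA, coe_bind, coe_bind,
      Measure.bind_apply (hz hA) (Kernel.aemeasurable _),
      Measure.bind_apply hA (Kernel.aemeasurable _), ProbabilityMeasure.toMeasure_map,
      lintegral_map (Kernel.measurable_coe _ hA) hz]
    refine lintegral_congr fun ω => ?_
    rw [hγ z Λ _ (hz hA), Set.image_preimage_eq _ fun η => ⟨_, shift_shift_neg z η⟩]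
  refine (γ.minEntropy_le μ ν' Λ).trans ?_
  have h := klDiv_map_le (marginal (translate z Λ) μ : Measure (translate z Λ → E))
    (marginal (translate z Λ) (γ.bind ν (translate z Λ)) : Measure (translate z Λ → E)) hr
  rwa [coe_marginal, coe_marginal, hmap, hmap, hμ.map_shift, hbind, ← coe_marginal,
    ← coe_marginal, ← coe_marginal, ← coe_marginal, marginal_bind, marginal_bind] at h

lemma packing_mul_minEntropy_le [StandardBorelSpace E] (hγ : γ.IsShiftInvariant)
    {μ : ProbabilityMeasure (Config d E)} (hμ : ShiftInvariant μ)
    (ν : ProbabilityMeasure (Config d E)) (m n : ℕ) :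
    (((2 * n + 1) / (2 * m + 1) : ℕ) : ℝ≥0∞) ^ d * γ.minEntropy μ (box d m) ≤
      klDiv (marginal (box d n) μ : Measure (box d n → E))
        (γ.gibbs ν (box d n) : Measure (box d n → E)) := by
  have h := γ.sum_minEntropy_le Finset.univ (fun t => translate (packing d m n t) (box d m))
    ((disjoint_translate_packing m n).set_pairwise _) μ (Q := γ.bind ν (box d n))
    fun t _ => γ.bind_bind ν (translate_packing_subset m n t)
  rw [← marginal_bind]
  refine le_trans ?_ (h.trans (klDiv_marginal_mono _ _
    (Finset.biUnion_subset.2 fun t _ => translate_packing_subset m n t)))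
  calc _ = ∑ t : Fin d → Fin ((2 * n + 1) / (2 * m + 1)), γ.minEntropy μ (box d m) := by
        simp
    _ ≤ _ := Finset.sum_le_sum fun t _ => minEntropy_le_translate hγ hμ _ _

lemma gibbs_mem_gibbsSet (ν : ProbabilityMeasure (Config d E)) (Λ : Finset (Site d)) :
    γ.gibbs ν Λ ∈ γ.gibbsSet Λ := ⟨ν, rfl⟩

lemma klDiv_gibbs_le {Λ : Finset (Site d)} (hΛ : maxDiam (γ.gibbsSet Λ) < ⊤)
    (μ ν : ProbabilityMeasure (Config d E)) :
    klDiv (marginal Λ μ : Measure (Λ → E)) (γ.gibbs ν Λ : Measure (Λ → E)) ≤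
      γ.minEntropy μ Λ + ENNReal.ofReal (maxDiam (γ.gibbsSet Λ)).toReal := by
  simp only [minEntropy, iInf_subtype', ENNReal.iInf_add]
  refine le_iInf fun π => ?_
  obtain ⟨h0, hle⟩ := toReal_maxDiam_nonneg_and_le_smul hΛ π.2 (gibbs_mem_gibbsSet ν Λ)
  have := klDiv_le_add_log (marginal Λ μ : Measure (Λ → E)) _ _ (Real.one_le_exp h0) hle
  rwa [Real.log_exp] at this

/-- The specific free energy exists and is the supremum of the normalized minimal entropies. -/
lemma isSpecificFreeEnergy_iSup [StandardBorelSpace E] (hγ : γ.WeaklyDependent)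
    {μ : ProbabilityMeasure (Config d E)} (hμ : ShiftInvariant μ) :
    γ.IsSpecificFreeEnergy μ (⨆ m, γ.minEntropy μ (box d m) / ((box d m).card : ℝ≥0∞)) := by
  have hcard : ∀ n, 0 < (box d n).card := fun n => by rw [card_box]; positivity
  intro ν
  simp_rw [marginal_bind]
  refine tendsto_of_le_liminf_of_limsup_le (iSup_le fun m => ?_) ?_
  -- Lower bound: the blocks in the packing number asymptotically `|Δ_n| / |Δ_m|`.
  · have ht := ENNReal.Tendsto.mul_const (b := γ.minEntropy μ (box d m))
      (tendsto_packing_density d m) (Or.inl (by simp))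
    rw [ENNReal.div_eq_inv_mul, ← ht.liminf_eq]
    refine liminf_le_liminf (Eventually.of_forall fun n => ?_)
    rw [ENNReal.div_eq_inv_mul, mul_assoc, ENNReal.div_eq_inv_mul]
    gcongr
    exact packing_mul_minEntropy_le hγ.shiftInvariant hμ ν m n
  -- Upper bound: replacing a near-optimal Gibbs measure by the given one costs `Diam = o(|Δ_n|)`.
  · have ht := (tendsto_const_nhds
      (x := ⨆ m, γ.minEntropy μ (box d m) / ((box d m).card : ℝ≥0∞)) (f := atTop)).add
      (ENNReal.tendsto_ofReal hγ.diam_isLittleO.tendsto_div_nhds_zero)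
    rw [ENNReal.ofReal_zero, add_zero] at ht
    refine le_of_le_of_eq (limsup_le_limsup (Eventually.of_forall fun n => ?_)) ht.limsup_eq
    rw [ENNReal.ofReal_div_of_pos (by exact_mod_cast hcard n), ENNReal.ofReal_natCast]
    calc _ ≤ (γ.minEntropy μ (box d n) +
          ENNReal.ofReal (maxDiam (γ.gibbsSet (box d n))).toReal) / ((box d n).card : ℝ≥0∞) := by
          exact ENNReal.div_le_div_right (klDiv_gibbs_le (hγ.diam_lt_top _) μ ν) _
      _ ≤ _ := by
          rw [ENNReal.add_div]
          gcongr
          exact le_iSup (fun m => γ.minEntropy μ (box d m) / ((box d m).card : ℝ≥0∞)) n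

lemma IsSpecificFreeEnergy.unique {μ : ProbabilityMeasure (Config d E)} {h h' : ℝ≥0∞}
    (hh : γ.IsSpecificFreeEnergy μ h) (hh' : γ.IsSpecificFreeEnergy μ h') : h = h' :=
  tendsto_nhds_unique (hh μ) (hh' μ)

lemma minEntropy_box_eq_zero [StandardBorelSpace E] (hγ : γ.WeaklyDependent)
    {μ : ProbabilityMeasure (Config d E)} (hμ : μ ∈ γ.minimizers) (n : ℕ) :
    γ.minEntropy μ (box d n) = 0 := by
  have h := (isSpecificFreeEnergy_iSup hγ hμ.1).unique hμ.2
  rw [ENNReal.iSup_eq_zero] at h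
  exact (ENNReal.div_eq_zero_iff.1 (h n)).resolve_right (ENNReal.natCast_ne_top _)

/-! ### Minimizers, local limits and strong closures. -/

lemma exists_gibbs_close {Λ : Finset (Site d)} {μ : ProbabilityMeasure (Config d E)}
    (h : γ.minEntropy μ Λ = 0) {ε : ℝ} (hε : 0 < ε) :
    ∃ ν : ProbabilityMeasure (Config d E), ∀ A : Set (Λ → E),
      |(marginal Λ μ : Measure (Λ → E)).real A - (γ.gibbs ν Λ : Measure (Λ → E)).real A| ≤ ε := by
  -- Entropy below `δ²` in the weak Pinsker bound gives `δ⁻¹ δ² + 2δ = 3δ`.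
  set δ := ε / 3 with hδ
  have hδ0 : 0 < δ := by positivity
  have hlt : γ.minEntropy μ Λ < ENNReal.ofReal (δ ^ 2) := by
    rw [h]; exact ENNReal.ofReal_pos.2 (by positivity)
  simp only [minEntropy, iInf_lt_iff] at hlt
  obtain ⟨_, ⟨ν, rfl⟩, hν⟩ := hlt
  refine ⟨ν, fun A => (abs_measureReal_sub_le_klDiv _ _ hν.ne_top hδ0 A).trans ?_⟩
  have h1 := ENNReal.toReal_le_of_le_ofReal (by positivity) hν.le
  calc _ ≤ δ⁻¹ * δ ^ 2 + 2 * δ := by gcongr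
    _ = ε := by rw [hδ]; field_simp; ring

lemma minimizers_subset_limits [StandardBorelSpace E] (hγ : γ.WeaklyDependent) :
    γ.minimizers ⊆ γ.limits := by
  intro μ hμ
  choose ν hν using fun n : ℕ => exists_gibbs_close (minEntropy_box_eq_zero hγ hμ n)
    (Nat.one_div_pos_of_nat (α := ℝ) (n := n))
  refine ⟨ν, tendsto_localTopology_iff.2 fun Λ A hA => ?_⟩
  obtain ⟨N, hN⟩ := exists_subset_box Λ
  rw [← ENNReal.tendsto_toReal_iff (fun _ => measure_ne_top _ _) (measure_ne_top _ _),
    tendsto_iff_dist_tendsto_zero]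
  refine squeeze_zero' (Eventually.of_forall fun _ => dist_nonneg) ?_
    tendsto_one_div_add_atTop_nhds_zero_nat
  filter_upwards [eventually_ge_atTop N] with n hn
  obtain ⟨B, hB, rfl⟩ := exists_eq_preimage_restrict
    (cylinderEvents_mono (Finset.coe_subset.2 (hN.trans (box_mono d hn))) A hA)
  have := hν n B
  rwa [← marginal_bind, measureReal_def, measureReal_def, marginal_apply _ _ hB,
    marginal_apply _ _ hB, abs_sub_comm] at this

lemma marginal_mem_closure_of_mem_limits {μ : ProbabilityMeasure (Config d E)}
    (hμ : μ ∈ γ.limits) (m : ℕ) :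
    marginal (box d m) μ ∈ closure[strongTopology (box d m → E)] (γ.gibbsSet (box d m)) := by
  obtain ⟨ν, hν⟩ := hμ
  rw [tendsto_localTopology_iff] at hν
  let := strongTopology (box d m → E)
  refine mem_closure_of_tendsto (f := fun n => marginal (box d m) (γ.bind (ν n) (box d n)))
    (b := atTop) (tendsto_strongTopology_iff.2 fun A hA => ?_) ?_
  · simp_rw [marginal_apply _ _ hA]
    exact hν _ _ (measurableSet_cylinderEvents_preimage_restrict hA)
  · filter_upwards [eventually_ge_atTop m] with n hn
    -- For `n ≥ m`, consistency makes the `Δ_m`-marginal of `ν_n γ_{Δ_n}` a Gibbs measure in `Δ_m`.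
    rw [← γ.bind_bind (ν n) (box_mono d hn), marginal_bind]
    exact gibbs_mem_gibbsSet _ _

/-- For fixed `A`, an upper bound on `P A` is a closed condition in the strong topology. -/
lemma le_smul_gibbs_of_mem_closure {Λ : Finset (Site d)} (hΛ : maxDiam (γ.gibbsSet Λ) < ⊤)
    {P : ProbabilityMeasure (Λ → E)}
    (hP : P ∈ closure[strongTopology (Λ → E)] (γ.gibbsSet Λ))
    (ν : ProbabilityMeasure (Config d E)) :
    (P : Measure (Λ → E)) ≤
      ENNReal.ofReal (Real.exp (maxDiam (γ.gibbsSet Λ)).toReal) •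
        (γ.gibbs ν Λ : Measure (Λ → E)) := by
  refine Measure.le_iff.2 fun A hA => ?_
  let := strongTopology (Λ → E)
  have hcont : Continuous fun P : ProbabilityMeasure (Λ → E) => (P : Measure (Λ → E)) A :=
    continuous_iff_continuousAt.2 fun Q => tendsto_strongTopology_iff.1 tendsto_id A hA
  exact closure_minimal (t := {P : ProbabilityMeasure (Λ → E) | (P : Measure (Λ → E)) A ≤ _})
    (fun Q hQ => (toReal_maxDiam_nonneg_and_le_smul hΛ hQ ⟨ν, rfl⟩).2 A)
    (isClosed_le hcont continuous_const) hP

lemma mem_minimizers_of_mem_closure (hγ : γ.WeaklyDependent)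
    {μ : ProbabilityMeasure (Config d E)} (hμ : ShiftInvariant μ)
    (h : ∀ n, marginal (box d n) μ ∈
      closure[strongTopology (box d n → E)] (γ.gibbsSet (box d n))) : μ ∈ γ.minimizers := by
  refine ⟨hμ, fun ν => ?_⟩
  have ht := ENNReal.tendsto_ofReal hγ.diam_isLittleO.tendsto_div_nhds_zero
  rw [ENNReal.ofReal_zero] at ht
  refine tendsto_of_tendsto_of_tendsto_of_le_of_le tendsto_const_nhds ht (fun _ => zero_le) ?_
  intro n
  have hcard : 0 < (box d n).card := by rw [card_box]; positivity
  have hlt := hγ.diam_lt_top (box d n)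
  have hmem := gibbs_mem_gibbsSet (γ := γ) ν (box d n)
  -- The intermediate measure is the marginal of `μ` itself, so only the cost `Diam` remains.
  have hle := klDiv_le_add_log (marginal (box d n) μ : Measure (box d n → E)) _ _
    (Real.one_le_exp (toReal_maxDiam_nonneg_and_le_smul hlt hmem hmem).1)
    (le_smul_gibbs_of_mem_closure hlt (h n) ν)
  rw [Real.log_exp, klDiv_self, zero_add] at hle
  simp only [marginal_bind]
  rw [ENNReal.ofReal_div_of_pos (by exact_mod_cast hcard), ENNReal.ofReal_natCast]
  gcongr

end Specification

end RandomField

theorem mainTheorem2 (d : ℕ) {E : Type*} [MeasurableSpace E] [StandardBorelSpace E]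
    (γ : RandomField.Specification d E) (hγ : γ.WeaklyDependent) :
    (∀ μ : ProbabilityMeasure (RandomField.Config d E), RandomField.ShiftInvariant μ →
      ∃! h : ℝ≥0∞, γ.IsSpecificFreeEnergy μ h) ∧
    γ.minimizers = γ.shiftInvariantLimits ∧
    ∀ μ : ProbabilityMeasure (RandomField.Config d E), RandomField.ShiftInvariant μ →
      (μ ∈ γ.minimizers ↔
        ∀ n : ℕ, RandomField.marginal (RandomField.box d n) μ ∈
          closure[RandomField.strongTopology (RandomField.box d n → E)]
            (γ.gibbsSet (RandomField.box d n))) := by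
  refine ⟨fun μ hμ => ⟨_, RandomField.Specification.isSpecificFreeEnergy_iSup hγ hμ,
    fun h hh => hh.unique (RandomField.Specification.isSpecificFreeEnergy_iSup hγ hμ)⟩,
    Set.Subset.antisymm
      (fun μ hμ => ⟨RandomField.Specification.minimizers_subset_limits hγ hμ, hμ.1⟩)
      (fun μ hμ => RandomField.Specification.mem_minimizers_of_mem_closure hγ hμ.2
        (RandomField.Specification.marginal_mem_closure_of_mem_limits hμ.1)),
    fun μ hμ => ⟨fun h => RandomField.Specification.marginal_mem_closure_of_mem_limits
        (RandomField.Specification.minimizers_subset_limits hγ h),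
      RandomField.Specification.mem_minimizers_of_mem_closure hγ hμ⟩⟩
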